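/- Let $\mathbb{T}^2=\mathbb{R}^2/\mathbb{Z}^2$, $\mathbb{S}^1=\mathbb{R}/\mathbb{Z}$, and let $2\le\ell\le r\le\infty$. Let $f:\mathbb{T}^2\to\mathbb{T}^2$ be an Anosov $C^r$ diffeomorphism that is conservative, i.e. preserves a volume given by a positive $C^\infty$ density. Let $\gamma:\mathbb{T}^2\to\mathbb{S}^1$ be a $C^r$ map that is a coboundary relative to $f$ with $C^\ell$ transfer map, i.e. $\gamma=\mu\circ f-\mu$ for some $C^\ell$ map $\mu:\mathbb{T}^2\to\mathbb{S}^1$. Then the skew-product $F:\mathbb{T}^2\times\mathbb{S}^1\to\mathbb{T}^2\times\mathbb{S}^1$, $F(p,t)=(f(p),\,t+\gamma(p))$, is not a partially hyperbolic contact $C^r$ diffeomorphism. Here a $C^r$ diffeomorphism $F$ of $M=\mathbb{T}^2\times\mathbb{S}^1$ is called a partially hyperbolic contact $C^r$ diffeomorphism if both of the following hold. (1) $F$ is partially hyperbolic: there are a Riemannian metric on $M$, a $DF$-invariant splitting $TM=E^s\oplus E^c\oplus E^u$ into continuous subbundles, and constants $C>0$, $0<\lambda<1$ such that $\|DF^n_pv\|\le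 C\lambda^n\|v\|$ for $v\in E^s_p$ and $\|DF^{-n}_pv\|\le C\lambda^n\|v\|$ for $v\in E^u_p$, for all $p\in M$ and $n\ge0$, and such that for every $p\in M$ there are $0<\mu_1<1<\mu_2$ with $\|DF_p|_{E^s_p}\|<\mu_1<\|DF_p|_{E^c_p}\|<\mu_2<\|DF_p|_{E^u_p}\|$. (2) $F$ preserves a contact form up to a positive factor: there are a $C^1$ one-form $\alpha$ on $M$ with $\alpha\wedge d\alpha\ne0$ at every point and a $C^\infty$ function $\tau:M\to(0,\infty)$ with $F^*\alpha=\tau\alpha$. -/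

import Mathlib

open Set Filter Topology MeasureTheory
open scoped ContDiff

noncomputable section

/-! ### Tori, their universal covers, smooth maps and derivatives -/

/-- The circle `ℝ/ℤ`. -/
abbrev S1 : Type := UnitAddCircle

/-- The torus `ℝ²/ℤ²`. -/
abbrev T2 : Type := UnitAddTorus (Fin 2)

/-- The torus `𝕋² × 𝕊¹`. -/
abbrev T3 : Type := T2 × S1

/-- The universal cover of `𝕋²`; it is also each tangent space of `𝕋²`, through the canonical
trivialization of the tangent bundle by translations. -/
abbrev E2 : Type := EuclideanSpace ℝ (Fin 2)

/-- The universal cover of `𝕋² × 𝕊¹`, and each of its tangent spaces. -/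
abbrev E3 : Type := E2 × ℝ

/-- The covering map `ℝ → 𝕊¹`. -/
def proj1 : ℝ →+ S1 := QuotientAddGroup.mk' (AddSubgroup.zmultiples (1 : ℝ))

/-- The covering map `ℝ² → 𝕋²`. -/
def proj2 : E2 →+ T2 where
  toFun x i := proj1 (x i)
  map_zero' := by ext i; simp
  map_add' x y := by ext i; simp

/-- The covering map `ℝ² × ℝ → 𝕋² × 𝕊¹`. -/
def proj3 : E3 →+ T3 := proj2.prodMap proj1

section General

variable {E X E' X' : Type*}
  [NormedAddCommGroup E] [NormedSpace ℝ E] [AddCommGroup X]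
  [NormedAddCommGroup E'] [NormedSpace ℝ E'] [AddCommGroup X']

/-- `G` is a lift of the map `g` between tori to the universal covers. -/
def IsLift (π : E →+ X) (π' : E' →+ X') (G : E → E') (g : X → X') : Prop :=
  ∀ x, π' (G x) = g (π x)

/-- A map between tori is of class `C^r` if it lifts to a `C^r` map of the universal covers. -/
def TorusContDiff (π : E →+ X) (π' : E' →+ X') (r : WithTop ℕ∞) (g : X → X') : Prop :=
  ∃ G : E → E', ContDiff ℝ r G ∧ IsLift π π' G g

/-- A `C^r` diffeomorphism of a torus. -/
def IsTorusDiffeo (π : E →+ X) (r : WithTop ℕ∞) (g : X ≃ X) : Prop :=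
  TorusContDiff π π r g ∧ TorusContDiff π π r g.symm

open Classical in
/-- The derivative `D g_p : T_p X → T_{g p} X` of a differentiable self-map of a torus, in the
canonical trivialization of the tangent bundle: the derivative of a differentiable lift of `g` at a
point above `p`. By `torusDeriv_eq` below, neither the lift nor the point matters. -/
def torusDeriv (π : E →+ X) (g : X → X) (p : X) : E →L[ℝ] E :=
  if h : ∃ (G : E → E) (x : E), Differentiable ℝ G ∧ IsLift π π G g ∧ π x = p then
    fderiv ℝ h.choose h.choose_spec.choose
  else 0

theorem torusDeriv_eq {π : E →+ X}
    (hπ : ∃ ε > 0, ∀ x, π x = 0 → ‖x‖ < ε → x = 0) {g : X → X} {G : E → E}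
    (hG : Differentiable ℝ G) (hl : IsLift π π G g) (x : E) :
    torusDeriv π g (π x) = fderiv ℝ G x := by
  have h : ∃ (G : E → E) (y : E), Differentiable ℝ G ∧ IsLift π π G g ∧ π y = π x :=
    ⟨G, x, hG, hl, rfl⟩
  have key : ∀ (H : E → E) (y : E), Differentiable ℝ H → IsLift π π H g → π y = π x →
      fderiv ℝ H y = fderiv ℝ G x := by
    intro H y hH hHl hy
    obtain ⟨ε, hε, hd⟩ := hπ
    have hc : Continuous (fun z => (H (z + (y - x)) - G z) - (H y - G x)) := by
      have := hH.continuous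
      have := hG.continuous
      fun_prop
    have hev : ∀ᶠ z in 𝓝 x, ‖(H (z + (y - x)) - G z) - (H y - G x)‖ < ε := by
      refine (hc.norm.tendsto x).eventually (gt_mem_nhds ?_)
      simpa using hε
    have heq : (fun z => H (z + (y - x))) =ᶠ[𝓝 x] fun z => G z + (H y - G x) := by
      filter_upwards [hev] with z hz
      have := hd _ (by simp only [map_sub, hHl _, hl _, map_add, hy]; simp) hz
      rw [sub_eq_zero, sub_eq_iff_eq_add] at this
      rw [this, add_comm]
    have hf := heq.fderiv_eq (𝕜 := ℝ)
    rw [fderiv_comp_add_right, fderiv_add_const] at hf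
    simpa using hf
  rw [torusDeriv, dif_pos h]
  obtain ⟨hH, hHl, hy⟩ := h.choose_spec.choose_spec
  exact key _ _ hH hHl hy

/-- A (continuous) vector subbundle of the tangent bundle of a torus. -/
def IsSubbundle [TopologicalSpace X] (V : X → Submodule ℝ E) : Prop :=
  ∃ k : ℕ, ∀ p, ∃ U ∈ 𝓝 p, ∃ e : Fin k → X → E, (∀ i, ContinuousOn (e i) U) ∧
    ∀ q ∈ U, LinearIndependent ℝ (fun i => e i q) ∧ V q = Submodule.span ℝ (range fun i => e i q)

/-- Invariance of a subbundle: `D g (V p) = V (g p)` for all `p`. -/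
def IsInvariantBundle (π : E →+ X) (g : X → X) (V : X → Submodule ℝ E) : Prop :=
  ∀ p, (V p).map (torusDeriv π g p).toLinearMap = V (g p)

/-- Anosov diffeomorphisms of a torus. By compactness, the flat metric may stand for any Riemannian
metric (only `C` changes). -/
def IsAnosov [TopologicalSpace X] (π : E →+ X) (g : X ≃ X) : Prop :=
  IsTorusDiffeo π 1 g ∧
  ∃ Es Eu : X → Submodule ℝ E, IsSubbundle Es ∧ IsSubbundle Eu ∧
    (∀ p, IsCompl (Es p) (Eu p)) ∧
    IsInvariantBundle π g Es ∧ IsInvariantBundle π g Eu ∧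
    ∃ C > (0 : ℝ), ∃ lam : ℝ, 0 < lam ∧ lam < 1 ∧ ∀ (n : ℕ) (p : X),
      (∀ v ∈ Es p, ‖torusDeriv π (g^[n]) p v‖ ≤ C * lam ^ n * ‖v‖) ∧
      (∀ v ∈ Eu p, ‖torusDeriv π (g.symm^[n]) p v‖ ≤ C * lam ^ n * ‖v‖)

/-! ### Partial hyperbolicity -/

/-- A smooth Riemannian metric on a torus. -/
structure TorusMetric (π : E →+ X) where
  /-- the inner product of the tangent space at a point -/
  inner : X → E →L[ℝ] E →L[ℝ] ℝ
  smooth : ContDiff ℝ ∞ (fun x => inner (π x))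
  symm : ∀ p u v, inner p u v = inner p v u
  pos : ∀ p v, v ≠ 0 → 0 < inner p v v

/-- The norm of a tangent vector `v` at `p`. -/
def TorusMetric.norm {π : E →+ X} (m : TorusMetric π) (p : X) (v : E) : ℝ :=
  Real.sqrt (m.inner p v v)

/-- The norm of the restriction to `V p` of the derivative of `g` at `p`. -/
def TorusMetric.restrNorm {π : E →+ X} (m : TorusMetric π) (g : X → X) (V : X → Submodule ℝ E)
    (p : X) : ℝ :=
  sSup {c | ∃ v ∈ V p, m.norm p v ≤ 1 ∧ c = m.norm (g p) (torusDeriv π g p v)}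

/-- Partially hyperbolic diffeomorphisms of a torus. -/
def IsPartiallyHyperbolic [TopologicalSpace X] (π : E →+ X) (g : X ≃ X) : Prop :=
  IsTorusDiffeo π 1 g ∧
  ∃ (m : TorusMetric π) (Es Ec Eu : X → Submodule ℝ E),
    IsSubbundle Es ∧ IsSubbundle Ec ∧ IsSubbundle Eu ∧
    (∀ p, DirectSum.IsInternal ![Es p, Ec p, Eu p]) ∧
    IsInvariantBundle π g Es ∧ IsInvariantBundle π g Ec ∧ IsInvariantBundle π g Eu ∧
    (∃ C > (0 : ℝ), ∃ lam : ℝ, 0 < lam ∧ lam < 1 ∧ ∀ (n : ℕ) (p : X),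
      (∀ v ∈ Es p, m.norm (g^[n] p) (torusDeriv π (g^[n]) p v) ≤ C * lam ^ n * m.norm p v) ∧
      (∀ v ∈ Eu p,
        m.norm (g.symm^[n] p) (torusDeriv π (g.symm^[n]) p v) ≤ C * lam ^ n * m.norm p v)) ∧
    ∀ p, ∃ mu1 mu2 : ℝ, 0 < mu1 ∧ mu1 < 1 ∧ 1 < mu2 ∧
      m.restrNorm g Es p < mu1 ∧ mu1 < m.restrNorm g Ec p ∧
      m.restrNorm g Ec p < mu2 ∧ mu2 < m.restrNorm g Eu p

/-! ### Contact forms and contact diffeomorphisms -/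

/-- The `1`-form on the universal cover induced by a `1`-form `α` on the torus. -/
def coverForm (π : E →+ X) (α : X → E →L[ℝ] ℝ) (x : E) : E [⋀^Fin 1]→L[ℝ] ℝ :=
  ContinuousAlternatingMap.ofSubsingleton ℝ E ℝ (0 : Fin 1) (α (π x))

/-- `dα(u, v)` at the point `π x`. -/
def dForm (π : E →+ X) (α : X → E →L[ℝ] ℝ) (x u v : E) : ℝ :=
  extDeriv (coverForm π α) x ![u, v]

theorem dForm_eq (π : E →+ X) (α : X → E →L[ℝ] ℝ) (x u v : E)
    (hα : DifferentiableAt ℝ (fun y => α (π y)) x) :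
    dForm π α x u v =
      fderiv ℝ (fun y => α (π y)) x u v - fderiv ℝ (fun y => α (π y)) x v u := by
  have hd : DifferentiableAt ℝ (coverForm π α) x :=
    (ContinuousAlternatingMap.ofSubsingletonLIE (𝕜 := ℝ) (E := E) (F := ℝ)
      (0 : Fin 1)).differentiableAt.comp x hα
  have key : ∀ w : E, ∀ c : Fin 1 → E,
      fderiv ℝ (fun y => coverForm π α y c) x w = fderiv ℝ (fun y => α (π y)) x w (c 0) := by
    intro w c
    have : (fun y => coverForm π α y c) = fun y => α (π y) (c 0) := by
      ext y; simp [coverForm]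
    rw [this, fderiv_clm_apply hα (differentiableAt_const _)]
    simp
  rw [dForm, extDeriv_apply hd]
  simp [Fin.sum_univ_two, key, sub_eq_add_neg]
  rfl

/-- `(α ∧ dα)(u, v, w)` at the point `π x`. -/
def contactVolume (π : E →+ X) (α : X → E →L[ℝ] ℝ) (x u v w : E) : ℝ :=
  α (π x) u * dForm π α x v w + α (π x) v * dForm π α x w u + α (π x) w * dForm π α x u v

end General

/-- A contact form on `𝕋² × 𝕊¹`: a `C¹` form `α` with `α ∧ dα ≠ 0` at every point. -/
def IsContactForm (α : T3 → E3 →L[ℝ] ℝ) : Prop :=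
  ContDiff ℝ 1 (fun x => α (proj3 x)) ∧ ∀ x, ∃ u v w, contactVolume proj3 α x u v w ≠ 0

/-- `F^* α = τ α` for a contact form `α` and a positive `C^∞` function `τ`. -/
def PreservesContactForm (F : T3 ≃ T3) : Prop :=
  ∃ α : T3 → E3 →L[ℝ] ℝ, IsContactForm α ∧
    ∃ τ : T3 → ℝ, ContDiff ℝ ∞ (fun x => τ (proj3 x)) ∧ (∀ p, 0 < τ p) ∧
      ∀ p v, α (F p) (torusDeriv proj3 F p v) = τ p * α p v

/-- Partially hyperbolic contact `C^r` diffeomorphisms of `𝕋² × 𝕊¹`. -/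
def IsPHContactDiffeo (r : WithTop ℕ∞) (F : T3 ≃ T3) : Prop :=
  IsTorusDiffeo proj3 r F ∧ IsPartiallyHyperbolic proj3 F ∧ PreservesContactForm F

/-! ### Skew-products, conservative maps, coboundaries -/

/-- The skew-product `(p, t) ↦ (f p, t + γ p)`. -/
def skewProduct (f : T2 ≃ T2) (γ : T2 → S1) : T3 ≃ T3 where
  toFun q := (f q.1, q.2 + γ q.1)
  invFun q := (f.symm q.1, q.2 - γ (f.symm q.1))
  left_inv q := by simp
  right_inv q := by simp

/-- `f` is conservative: it preserves the volume given by some positive `C^∞` density. -/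
def IsConservative (f : T2 → T2) : Prop :=
  ∃ ρ : T2 → ℝ, ContDiff ℝ ∞ (fun x => ρ (proj2 x)) ∧ (∀ p, 0 < ρ p) ∧
    MeasurePreserving f (volume.withDensity fun p => ENNReal.ofReal (ρ p))
      (volume.withDensity fun p => ENNReal.ofReal (ρ p))

/-- `γ` is a coboundary relative to `f` with a `C^ℓ` transfer map `μ : 𝕋² → 𝕊¹`. -/
def IsCoboundary (ℓ : WithTop ℕ∞) (f : T2 → T2) (γ : T2 → S1) : Prop :=
  ∃ μ : T2 → S1, TorusContDiff proj2 proj1 ℓ μ ∧ ∀ p, γ p = μ (f p) - μ p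

/-! ### The coverings have discrete kernels, so that `torusDeriv_eq` applies to them -/

theorem proj1_discrete : ∃ ε > 0, ∀ x, proj1 x = 0 → ‖x‖ < ε → x = 0 := by
  refine ⟨1, one_pos, fun x hx h => ?_⟩
  obtain ⟨n, rfl⟩ := (AddCircle.coe_eq_zero_iff (1 : ℝ)).1 hx
  have h' : |(n : ℝ)| < 1 := by simpa using h
  have : n = 0 := Int.abs_lt_one_iff.1 (by exact_mod_cast h')
  simp [this]

theorem proj2_discrete : ∃ ε > 0, ∀ x, proj2 x = 0 → ‖x‖ < ε → x = 0 := by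
  obtain ⟨ε, hε, h⟩ := proj1_discrete
  refine ⟨ε, hε, fun x hx hn => ?_⟩
  ext i
  exact h (x i) (congrFun hx i) ((PiLp.norm_apply_le x i).trans_lt hn)

theorem proj3_discrete : ∃ ε > 0, ∀ x, proj3 x = 0 → ‖x‖ < ε → x = 0 := by
  obtain ⟨ε, hε, h⟩ := proj1_discrete
  obtain ⟨δ, hδ, h'⟩ := proj2_discrete
  refine ⟨min ε δ, lt_min hε hδ, fun x hx hn => ?_⟩
  exact Prod.ext
    (h' x.1 (congrArg Prod.fst hx)
      ((norm_fst_le x).trans_lt (hn.trans_le (min_le_right _ _))))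
    (h x.2 (congrArg Prod.snd hx)
      ((norm_snd_le x).trans_lt (hn.trans_le (min_le_left _ _))))

end

/-! Write `γ = μ ∘ f - μ`. Then `F` permutes the graphs of `μ + const`, so a form `α` with `F^*α =
τα` restricts on them to a family of linear forms on `ℝ²` that `f` multiplies by `τ`. The factor `τ`
can be normalized away. On one hand `α ∧ dα` is multiplied by `τ²` (`contactVolume_fderiv`). On the
other, `det DF = det Df`, which is `±ρ / (ρ ∘ f)` because `f` preserves the density `ρ`
(`abs_det_fderiv_mul_density`). Hence `|α ∧ dα| / ρ` is multiplied by exactly `τ²`, and dividing the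
restricted forms by its square root makes them invariant (`normalizedGraphForm_skewLift`).

The normalized forms descend to a compact torus, so they are bounded. An invariant bounded form
kills every vector contracted under forward iteration, and likewise under backward iteration
(`eq_zero_of_invariant_of_contracted`); stable and unstable vectors span, so it is zero. Thus `ker
α` is tangent to the graphs: `α` is a multiple of the closed form `dt - dμ`, and `α ∧ dα = 0`
(`not_isContactForm_of_graph`). -/

/-! ### Lifts and their derivatives -/

theorem IsLift.iterate {E X : Type*} [NormedAddCommGroup E] [AddCommGroup X]
    {π : E →+ X} {G : E → E} {g : X → X} (h : IsLift π π G g) (n : ℕ) :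
    IsLift π π G^[n] g^[n] := by
  intro x
  have : Function.Semiconj π G g := h
  exact (this.iterate_right n).eq x

theorem IsLift.comp {E X : Type*} [NormedAddCommGroup E] [AddCommGroup X]
    {π : E →+ X} {G H : E → E} {g h : X → X} (hG : IsLift π π G g)
    (hH : IsLift π π H h) : IsLift π π (G ∘ H) (g ∘ h) := fun x => by
  simp [hG _, hH _]

section Lifts

variable {E X E' X' : Type*}
  [NormedAddCommGroup E] [NormedSpace ℝ E] [AddCommGroup X]
  [NormedAddCommGroup E'] [NormedSpace ℝ E'] [AddCommGroup X']

/-- Two lifts of the same map have the same derivative at points with the same projection. -/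
theorem IsLift.fderiv_eq {π : E →+ X} {π' : E' →+ X'}
    (hπ' : ∃ ε > 0, ∀ x, π' x = 0 → ‖x‖ < ε → x = 0) {g : X → X'} {G H : E → E'}
    (hG : Continuous G) (hH : Continuous H) (hl : IsLift π π' G g) (hHl : IsLift π π' H g)
    {x y : E} (hy : π y = π x) : fderiv ℝ H y = fderiv ℝ G x := by
  obtain ⟨ε, hε, hd⟩ := hπ'
  -- The difference of the two lifts, recentred at `x`, takes values in `ker π'`; near `x` it is
  -- small, hence zero by discreteness.
  have hc : Continuous (fun z => (H (z + (y - x)) - G z) - (H y - G x)) := by fun_prop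
  have hev : ∀ᶠ z in 𝓝 x, ‖(H (z + (y - x)) - G z) - (H y - G x)‖ < ε := by
    refine (hc.norm.tendsto x).eventually (gt_mem_nhds ?_)
    simpa using hε
  have heq : (fun z => H (z + (y - x))) =ᶠ[𝓝 x] fun z => G z + (H y - G x) := by
    filter_upwards [hev] with z hz
    have := hd _ (by simp only [map_sub, hHl _, hl _, map_add, hy]; simp) hz
    rw [sub_eq_zero, sub_eq_iff_eq_add] at this
    rw [this, add_comm]
  have hf := heq.fderiv_eq (𝕜 := ℝ)
  rw [fderiv_comp_add_right, fderiv_add_const] at hf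
  simpa using hf

theorem fderiv_comp_proj_eq (π : E →+ X) (g : X → E') {x y : E} (hy : π y = π x) :
    fderiv ℝ (fun z => g (π z)) y = fderiv ℝ (fun z => g (π z)) x := by
  have h : (fun z => g (π (z + (y - x)))) = fun z => g (π z) := by
    ext z; simp [hy]
  have h' := fderiv_comp_add_right (𝕜 := ℝ) (f := fun z => g (π z)) (x := x) (y - x)
  rw [h] at h'
  simpa using h'.symm

/-- Lifts of mutually inverse maps have mutually inverse derivatives. -/
theorem IsLift.fderiv_comp_fderiv_of_inverse {π : E →+ X}
    (hπ : ∃ ε > 0, ∀ x, π x = 0 → ‖x‖ < ε → x = 0) {g : X ≃ X} {G H : E → E}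
    (hG : Differentiable ℝ G) (hH : Differentiable ℝ H) (hl : IsLift π π G g)
    (hHl : IsLift π π H g.symm) (x v : E) : fderiv ℝ G (H x) (fderiv ℝ H x v) = v := by
  have h1 : IsLift π π (G ∘ H) id := by
    have := hl.comp hHl
    simpa using this
  have h2 := IsLift.fderiv_eq hπ continuous_id (hG.continuous.comp hH.continuous)
    (fun _ => rfl) h1 (rfl : π x = π x)
  rw [fderiv_comp x (hG _) (hH _), fderiv_id] at h2
  simpa using congrArg (fun L => L v) h2

end Lifts

/-! ### Topology of the covering maps -/

theorem isOpenQuotientMap_proj1 : IsOpenQuotientMap proj1 :=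
  QuotientAddGroup.isOpenQuotientMap_mk

theorem isOpenQuotientMap_proj2 : IsOpenQuotientMap proj2 :=
  (IsOpenQuotientMap.piMap fun _ : Fin 2 => isOpenQuotientMap_proj1).comp
    (EuclideanSpace.equiv (Fin 2) ℝ).toHomeomorph.isOpenQuotientMap

theorem isOpenQuotientMap_proj3 : IsOpenQuotientMap proj3 :=
  isOpenQuotientMap_proj2.prodMap isOpenQuotientMap_proj1

/-- A continuous function on the universal cover that descends to the torus is bounded. -/
theorem exists_norm_le_of_proj3_invariant {F : Type*} [SeminormedAddCommGroup F] {g : E3 → F}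
    (hg : Continuous g) (h : ∀ x y, proj3 x = proj3 y → g x = g y) : ∃ C, ∀ x, ‖g x‖ ≤ C := by
  have hs := isOpenQuotientMap_proj3.surjective
  -- An arbitrary section suffices: the descended function is continuous because `proj3` is a
  -- quotient map.
  have he : (g ∘ Function.surjInv hs) ∘ proj3 = g := by
    ext x
    exact h _ _ (Function.surjInv_eq hs _)
  have hc : Continuous (g ∘ Function.surjInv hs) := by
    rw [← isOpenQuotientMap_proj3.continuous_comp_iff, he]
    exact hg
  obtain ⟨C, hC⟩ := (isCompact_range hc).isBounded.exists_norm_le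
  refine ⟨C, fun x => hC _ ⟨proj3 x, congrFun he x⟩⟩

/-! ### Conservative maps -/

/-- The half-open unit square of `ℝ²` with lower left corner `a`. -/
def unitBox (a : E2) : Set E2 := {x | ∀ i, x i ∈ Ioc (a i) (a i + 1)}

theorem measurePreserving_proj2 (a : E2) :
    MeasurePreserving proj2 (volume.restrict (unitBox a)) volume := by
  have h1 : MeasurePreserving (fun (x : Fin 2 → ℝ) i => (proj1 (x i) : S1))
      (volume.restrict (univ.pi fun i => Ioc (a i) (a i + 1))) volume := by
    rw [volume_pi, volume_pi, Measure.restrict_pi_pi]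
    exact measurePreserving_pi _ _ fun i => UnitAddCircle.measurePreserving_mk (a i)
  have h2 := (PiLp.volume_preserving_ofLp (Fin 2)).restrict_preimage
    (s := univ.pi fun i => Ioc (a i) (a i + 1))
    (MeasurableSet.univ_pi fun i => measurableSet_Ioc)
  have h3 : WithLp.ofLp ⁻¹' (univ.pi fun i => Ioc (a i) (a i + 1)) = unitBox a := by
    ext x; simp [unitBox]
  rw [h3] at h2
  exact h1.comp h2

theorem injOn_proj2_unitBox (a : E2) : InjOn proj2 (unitBox a) := by
  intro x hx y hy hxy
  ext i
  have h : (x i : S1) = (y i : S1) := congrFun hxy i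
  exact (AddCircle.coe_eq_coe_iff_of_mem_Ioc (p := (1 : ℝ)) (hx i) (hy i)).1 h

theorem unitBox_mem_nhds (x : E2) : ∃ a, unitBox a ∈ 𝓝 x := by
  refine ⟨x - WithLp.toLp 2 fun _ => 1 / 2, ?_⟩
  have : ∀ i : Fin 2, ∀ᶠ y : E2 in 𝓝 x, y i ∈ Ioc (x i - 1 / 2) (x i - 1 / 2 + 1) := by
    intro i
    have hc : Continuous fun y : E2 => y i := by fun_prop
    exact (hc.tendsto x).eventually (Ioc_mem_nhds (by linarith) (by linarith))
  filter_upwards [eventually_all.2 this] with y hy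
  intro i
  simpa using hy i

/-- Inside a unit box the covering is injective and measure preserving, so integrals on the torus
can be computed upstairs. -/
theorem setLIntegral_proj2_image {a : E2} {S : Set E2} (hS : MeasurableSet S)
    (hSa : S ⊆ unitBox a) {g : T2 → ENNReal} (hg : Measurable g) :
    ∫⁻ p in proj2 '' S, g p = ∫⁻ x in S, g (proj2 x) := by
  have hm : MeasurableSet (proj2 '' S) := hS.image_of_continuousOn_injOn
    isOpenQuotientMap_proj2.continuous.continuousOn ((injOn_proj2_unitBox a).mono hSa)
  rw [← (measurePreserving_proj2 a).setLIntegral_comp_preimage hm hg,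
    Measure.restrict_restrict (isOpenQuotientMap_proj2.continuous.measurable hm),
    (injOn_proj2_unitBox a).preimage_image_inter hSa]

/-- The Jacobian of a conservative diffeomorphism. -/
theorem abs_det_fderiv_mul_density {f : T2 ≃ T2} {G : E2 → E2} (hG : ContDiff ℝ 1 G)
    (hl : IsLift proj2 proj2 G f) {ρ : T2 → ℝ} (hρ : Continuous fun x => ρ (proj2 x))
    (hpos : ∀ p, 0 < ρ p)
    (hf : MeasurePreserving f (volume.withDensity fun p => ENNReal.ofReal (ρ p))
      (volume.withDensity fun p => ENNReal.ofReal (ρ p))) (x : E2) :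
    |(fderiv ℝ G x).det| * ρ (f (proj2 x)) = ρ (proj2 x) := by
  have hρc : Continuous ρ := isOpenQuotientMap_proj2.continuous_comp_iff.1 hρ
  set g : T2 → ENNReal := fun p => ENNReal.ofReal (ρ p) with hg
  have hgc : Continuous g := ENNReal.continuous_ofReal.comp hρc
  have hgm : Measurable g := hgc.measurable
  obtain ⟨a, ha⟩ := unitBox_mem_nhds x
  obtain ⟨b, hb⟩ := unitBox_mem_nhds (G x)
  -- `U` and `G '' U` each lie in one unit box, so the covering is injective on both.
  obtain ⟨U, hU, hUo, hxU⟩ := mem_nhds_iff.1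
    (inter_mem ha (hG.continuous.continuousAt.preimage_mem_nhds hb))
  have hdet : Continuous fun y => |(fderiv ℝ G y).det| :=
    (ContinuousLinearMap.continuous_det.comp (hG.continuous_fderiv one_ne_zero)).abs
  have hinj : InjOn G U := by
    intro y hy z hz hyz
    refine injOn_proj2_unitBox a (hU hy).1 (hU hz).1 (f.injective ?_)
    rw [← hl, ← hl, hyz]
  -- Both sides are the measure of `proj2 '' S`: directly, and through its image under `f` by change
  -- of variables.
  have key : ∀ S ⊆ U, MeasurableSet S → ∫⁻ y in S, g (proj2 y) =
      ∫⁻ y in S, ENNReal.ofReal |(fderiv ℝ G y).det| * g (proj2 (G y)) := by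
    intro S hSU hS
    have hGS : MeasurableSet (G '' S) :=
      hS.image_of_continuousOn_injOn hG.continuous.continuousOn (hinj.mono hSU)
    have hGSb : G '' S ⊆ unitBox b := by
      rintro _ ⟨y, hy, rfl⟩
      exact (hU (hSU hy)).2
    have himage : proj2 '' (G '' S) = f '' (proj2 '' S) := by
      rw [image_image, image_image]
      exact image_congr fun y _ => hl y
    have hm1 : MeasurableSet (proj2 '' (G '' S)) := hGS.image_of_continuousOn_injOn
      isOpenQuotientMap_proj2.continuous.continuousOn ((injOn_proj2_unitBox b).mono hGSb)
    have hm2 : MeasurableSet (proj2 '' S) := hS.image_of_continuousOn_injOn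
      isOpenQuotientMap_proj2.continuous.continuousOn
        ((injOn_proj2_unitBox a).mono fun y hy => (hU (hSU hy)).1)
    have hmp := hf.measure_preimage hm1.nullMeasurableSet
    rw [himage, f.preimage_image, ← himage, withDensity_apply _ hm1, withDensity_apply _ hm2,
      setLIntegral_proj2_image hS (fun y hy => (hU (hSU hy)).1) hgm,
      setLIntegral_proj2_image hGS hGSb hgm,
      lintegral_image_eq_lintegral_abs_det_fderiv_mul volume hS
        (fun y _ => ((hG.differentiable one_ne_zero) y).hasFDerivAt.hasFDerivWithinAt)
        (hinj.mono hSU)] at hmp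
    exact hmp
  have hc1 : Continuous fun y => g (proj2 y) := hgc.comp isOpenQuotientMap_proj2.continuous
  have hc2 : Continuous fun y =>
      ENNReal.ofReal (|(fderiv ℝ G y).det| * ρ (proj2 (G y))) :=
    ENNReal.continuous_ofReal.comp (hdet.mul (hρ.comp hG.continuous))
  have hmul : ∀ y, ENNReal.ofReal (|(fderiv ℝ G y).det| * ρ (proj2 (G y))) =
      ENNReal.ofReal |(fderiv ℝ G y).det| * g (proj2 (G y)) := fun y =>
    ENNReal.ofReal_mul (abs_nonneg _)
  have hae : (fun y => g (proj2 y)) =ᵐ[volume.restrict U] fun y =>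
      ENNReal.ofReal (|(fderiv ℝ G y).det| * ρ (proj2 (G y))) := by
    refine ae_eq_of_forall_setLIntegral_eq_of_sigmaFinite hc1.measurable hc2.measurable
      fun S hS _ => ?_
    rw [Measure.restrict_restrict hS]
    simp only [hmul]
    exact key _ inter_subset_right (hS.inter hUo.measurableSet)
  -- Continuity upgrades almost everywhere equality to equality at the point `x`.
  have := Measure.eqOn_open_of_ae_eq hae hUo hc1.continuousOn hc2.continuousOn hxU
  have h2 := (ENNReal.ofReal_eq_ofReal_iff (hpos _).le
    (mul_nonneg (abs_nonneg _) (hpos _).le)).1 this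
  rw [← hl x]
  exact h2.symm

/-! ### The contact volume -/

section ContactVolume

variable {E X : Type*} [NormedAddCommGroup E] [NormedSpace ℝ E] [AddCommGroup X]

/-- The transformation law of `α ∧ dα` under a `C²` map that multiplies `α` by `τ`. -/
theorem contactVolume_fderiv {π : E →+ X} {α : X → E →L[ℝ] ℝ}
    (hα : ContDiff ℝ 1 fun x => α (π x)) {P : E → E} (hP : ContDiff ℝ 2 P) {τ : E → ℝ}
    (hτ : Differentiable ℝ τ)
    (h : ∀ x v, α (π (P x)) (fderiv ℝ P x v) = τ x * α (π x) v) (x u v w : E) :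
    contactVolume π α (P x) (fderiv ℝ P x u) (fderiv ℝ P x v) (fderiv ℝ P x w) =
      τ x ^ 2 * contactVolume π α x u v w := by
  have hαd : Differentiable ℝ fun x => α (π x) := hα.differentiable one_ne_zero
  have hPd : Differentiable ℝ P := hP.differentiable two_ne_zero
  have hP' : Differentiable ℝ (fderiv ℝ P) :=
    (hP.fderiv_right (m := 1) (by norm_num)).differentiable one_ne_zero
  have hsymm : ∀ u v, fderiv ℝ (fderiv ℝ P) x u v = fderiv ℝ (fderiv ℝ P) x v u :=
    (hP.contDiffAt.isSymmSndFDerivAt (x := x) (by simp)).eq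
  set a : E → E →L[ℝ] ℝ := fun x => α (π x) with ha
  -- Differentiate the hypothesis in the direction `u`. Antisymmetrizing in `u`, `v` then cancels
  -- the second derivative of `P`.
  have hderiv : ∀ u v, fderiv ℝ a (P x) (fderiv ℝ P x u) (fderiv ℝ P x v) +
      a (P x) (fderiv ℝ (fderiv ℝ P) x u v) =
      fderiv ℝ τ x u * a x v + τ x * fderiv ℝ a x u v := by
    intro u v
    have h1 : HasFDerivAt (fun y => a (P y)) ((fderiv ℝ a (P x)).comp (fderiv ℝ P x)) x :=
      (hαd (P x)).hasFDerivAt.comp x (hPd x).hasFDerivAt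
    have h2 : HasFDerivAt (fun y => fderiv ℝ P y v)
        ((fderiv ℝ (fderiv ℝ P) x).flip v) x := by
      simpa using (hP' x).hasFDerivAt.clm_apply (hasFDerivAt_const v x)
    have h3 := h1.clm_apply h2
    have h4 : HasFDerivAt (fun y => a y v) ((fderiv ℝ a x).flip v) x := by
      simpa using (hαd x).hasFDerivAt.clm_apply (hasFDerivAt_const v x)
    have h5 := (hτ x).hasFDerivAt.mul h4
    have h6 : (fun y => a (P y) (fderiv ℝ P y v)) = fun y => τ y * a y v := funext fun y => h y v
    rw [h6] at h3
    have h7 := congrArg (fun L => L u) (h3.unique h5)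
    simp only [add_apply, ContinuousLinearMap.comp_apply,
      ContinuousLinearMap.flip_apply, smul_apply, smul_eq_mul] at h7
    linarith
  have hd : ∀ u v, dForm π α (P x) (fderiv ℝ P x u) (fderiv ℝ P x v) =
      fderiv ℝ τ x u * a x v - fderiv ℝ τ x v * a x u + τ x * dForm π α x u v := by
    intro u v
    rw [dForm_eq _ _ _ _ _ (hαd _), dForm_eq _ _ _ _ _ (hαd _)]
    have h1 := hderiv u v
    have h2 := hderiv v u
    rw [hsymm v u] at h2
    linarith
  -- The term `dτ ∧ α` in the pullback of `dα` disappears after wedging with `α`.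
  simp only [contactVolume, hd, h]
  ring

/-- If `α = bθ` with `dθ = 0`, then `dα = db ∧ θ`, and `θ ∧ db ∧ θ = 0`. -/
theorem contactVolume_eq_zero_of_eq_mul_closed {π : E →+ X} {α : X → E →L[ℝ] ℝ}
    {b : E → ℝ} {θ : E → E →L[ℝ] ℝ} (hb : Differentiable ℝ b) (hθ : Differentiable ℝ θ)
    (h : ∀ y, α (π y) = b y • θ y) {x : E}
    (hclosed : ∀ u v, fderiv ℝ θ x u v = fderiv ℝ θ x v u) (u v w : E) :
    contactVolume π α x u v w = 0 := by
  have hfun : (fun y => α (π y)) = fun y => b y • θ y := funext h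
  have hα : DifferentiableAt ℝ (fun y => α (π y)) x := by
    rw [hfun]; exact (hb x).smul (hθ x)
  have hd : ∀ u v, dForm π α x u v = fderiv ℝ b x u * θ x v - fderiv ℝ b x v * θ x u := by
    intro u v
    rw [dForm_eq _ _ _ _ _ hα, hfun, fderiv_fun_smul (hb x) (hθ x)]
    simp [hclosed v u]
  simp only [contactVolume, hd, h]
  simp
  ring

end ContactVolume

/-- The value of `α ∧ dα` on the standard basis of `ℝ² × ℝ`. -/
noncomputable def stdContactVolume (α : T3 → E3 →L[ℝ] ℝ) (x : E3) : ℝ :=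
  contactVolume proj3 α x (EuclideanSpace.single 0 1, 0) (EuclideanSpace.single 1 1, 0) (0, 1)

theorem E3.eq_sum_basis (u : E3) :
    u = u.1 0 • ((EuclideanSpace.single 0 1, 0) : E3) +
      u.1 1 • ((EuclideanSpace.single 1 1, 0) : E3) + u.2 • ((0, 1) : E3) := by
  refine Prod.ext ?_ (by simp)
  ext i
  fin_cases i <;> simp

/-- An alternating 3-form on a 3-dimensional space is a determinant times its value on a basis. -/
theorem contactVolume_eq_stdContactVolume {α : T3 → E3 →L[ℝ] ℝ} {x : E3}
    (hα : DifferentiableAt ℝ (fun y => α (proj3 y)) x) (u v w : E3) :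
    contactVolume proj3 α x u v w =
      (u.1 0 * (v.1 1 * w.2 - v.2 * w.1 1) - u.1 1 * (v.1 0 * w.2 - v.2 * w.1 0) +
        u.2 * (v.1 0 * w.1 1 - v.1 1 * w.1 0)) * stdContactVolume α x := by
  have hL : ∀ (L : E3 →L[ℝ] ℝ) (u : E3), L u = u.1 0 * L (EuclideanSpace.single 0 1, 0) +
      u.1 1 * L (EuclideanSpace.single 1 1, 0) + u.2 * L (0, 1) := by
    intro L u
    conv_lhs => rw [E3.eq_sum_basis u]
    simp only [map_add, map_smul, smul_eq_mul]
  have hB : ∀ (B : E3 →L[ℝ] E3 →L[ℝ] ℝ) (u v : E3), B u v =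
      u.1 0 * B (EuclideanSpace.single 0 1, 0) v + u.1 1 * B (EuclideanSpace.single 1 1, 0) v +
        u.2 * B (0, 1) v := by
    intro B u v
    conv_lhs => rw [E3.eq_sum_basis u]
    simp only [map_add, map_smul, add_apply, smul_apply, smul_eq_mul]
  simp only [stdContactVolume, contactVolume, dForm_eq _ _ _ _ _ hα]
  set B := fderiv ℝ (fun y => α (proj3 y)) x
  rw [hL (α (proj3 x)) u, hL (α (proj3 x)) v, hL (α (proj3 x)) w,
    hB B u v, hB B v u, hB B v w, hB B w v, hB B w u, hB B u w]
  simp only [hL (B _) u, hL (B _) v, hL (B _) w]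
  ring

theorem det_eq_of_euclidean (L : E2 →L[ℝ] E2) :
    L.det = L (EuclideanSpace.single 0 1) 0 * L (EuclideanSpace.single 1 1) 1 -
      L (EuclideanSpace.single 0 1) 1 * L (EuclideanSpace.single 1 1) 0 := by
  have h := LinearMap.det_toMatrix (EuclideanSpace.basisFun (Fin 2) ℝ).toBasis (L : E2 →ₗ[ℝ] E2)
  rw [ContinuousLinearMap.det, ← h, Matrix.det_fin_two]
  simp [LinearMap.toMatrix_apply]
  ring

/-! ### Lifts of skew-products over coboundaries -/

/-- The lift of the skew-product by `μ ∘ f - μ`, for lifts `G` of `f` and `M` of `μ`. -/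
def skewLift (G : E2 → E2) (M : E2 → ℝ) (y : E3) : E3 :=
  (G y.1, y.2 + (M (G y.1) - M y.1))

section SkewLift

variable {G : E2 → E2} {M : E2 → ℝ}

theorem isLift_skewLift {f : T2 ≃ T2} {γ μ : T2 → S1} (hG : IsLift proj2 proj2 G f)
    (hM : IsLift proj2 proj1 M μ) (hγ : ∀ p, γ p = μ (f p) - μ p) :
    IsLift proj3 proj3 (skewLift G M) (skewProduct f γ) := by
  intro y
  refine Prod.ext (hG y.1) ?_
  change proj1 (y.2 + (M (G y.1) - M y.1)) = proj1 y.2 + γ (proj2 y.1)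
  rw [map_add, map_sub, hM, hM, hG, hγ]

theorem contDiff_skewLift {n : WithTop ℕ∞} (hG : ContDiff ℝ n G) (hM : ContDiff ℝ n M) :
    ContDiff ℝ n (skewLift G M) :=
  (hG.comp contDiff_fst).prodMk (contDiff_snd.add
    ((hM.comp (hG.comp contDiff_fst)).sub (hM.comp contDiff_fst)))

theorem fderiv_skewLift (hG : Differentiable ℝ G) (hM : Differentiable ℝ M) (y v : E3) :
    fderiv ℝ (skewLift G M) y v = (fderiv ℝ G y.1 v.1,
      v.2 + (fderiv ℝ M (G y.1) (fderiv ℝ G y.1 v.1) - fderiv ℝ M y.1 v.1)) := by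
  have h1 : HasFDerivAt (fun y : E3 => G y.1) _ y :=
    (hG y.1).hasFDerivAt.comp y hasFDerivAt_fst
  have h2 : HasFDerivAt (fun y : E3 => M y.1) _ y :=
    (hM y.1).hasFDerivAt.comp y hasFDerivAt_fst
  have h3 : HasFDerivAt (fun y : E3 => M (G y.1)) _ y :=
    (hM (G y.1)).hasFDerivAt.comp y h1
  have h4 : HasFDerivAt (skewLift G M) _ y := h1.prodMk (hasFDerivAt_snd.add (h3.sub h2))
  rw [h4.fderiv]
  rfl

end SkewLift

/-! ### The contact volume and its conservative renormalization -/

section Volume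

variable {α : T3 → E3 →L[ℝ] ℝ}

theorem stdContactVolume_congr (hα : ContDiff ℝ 1 fun x => α (proj3 x)) {x y : E3}
    (h : proj3 x = proj3 y) : stdContactVolume α x = stdContactVolume α y := by
  have hd := hα.differentiable one_ne_zero
  simp only [stdContactVolume, contactVolume, dForm_eq _ _ _ _ _ (hd _),
    fderiv_comp_proj_eq proj3 α h, h]

theorem continuous_stdContactVolume (hα : ContDiff ℝ 1 fun x => α (proj3 x)) :
    Continuous (stdContactVolume α) := by
  have hd := hα.differentiable one_ne_zero
  have h1 : ∀ u, Continuous fun x => α (proj3 x) u := fun u =>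
    hα.continuous.clm_apply continuous_const
  have h2 : ∀ u v, Continuous fun x => dForm proj3 α x u v := by
    intro u v
    simp only [dForm_eq _ _ _ _ _ (hd _)]
    have h3 := hα.continuous_fderiv one_ne_zero
    exact ((h3.clm_apply continuous_const).clm_apply continuous_const).sub
      ((h3.clm_apply continuous_const).clm_apply continuous_const)
  exact (((h1 _).mul (h2 _ _)).add ((h1 _).mul (h2 _ _))).add ((h1 _).mul (h2 _ _))

theorem stdContactVolume_ne_zero (hα : IsContactForm α) (x : E3) : stdContactVolume α x ≠ 0 := by
  obtain ⟨u, v, w, h⟩ := hα.2 x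
  rw [contactVolume_eq_stdContactVolume (hα.1.differentiable one_ne_zero x)] at h
  exact right_ne_zero_of_mul h

/-- The derivative of the skew-product is block triangular with `1` in the fiber direction, so its
determinant is that of `G`. -/
theorem stdContactVolume_skewLift {G : E2 → E2} {M : E2 → ℝ} (hG : ContDiff ℝ 2 G)
    (hM : ContDiff ℝ 2 M) (hα : ContDiff ℝ 1 fun x => α (proj3 x)) {τ : E3 → ℝ}
    (hτ : Differentiable ℝ τ)
    (h : ∀ x v, α (proj3 (skewLift G M x)) (fderiv ℝ (skewLift G M) x v) = τ x * α (proj3 x) v)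
    (y : E3) : (fderiv ℝ G y.1).det * stdContactVolume α (skewLift G M y) =
      τ y ^ 2 * stdContactVolume α y := by
  have h1 := contactVolume_fderiv hα (contDiff_skewLift hG hM) hτ h y
    (EuclideanSpace.single 0 1, 0) (EuclideanSpace.single 1 1, 0) (0, 1)
  rw [contactVolume_eq_stdContactVolume (hα.differentiable one_ne_zero _)] at h1
  simp only [fderiv_skewLift (hG.differentiable two_ne_zero) (hM.differentiable two_ne_zero)] at h1
  change _ = τ y ^ 2 * stdContactVolume α y at h1
  rw [← h1, det_eq_of_euclidean]
  simp

end Volume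

/-- The restriction of `α` to the graphs of `M + const`, seen as a form on `ℝ²` and divided by the
square root of the contact volume relative to the density `ρ`. -/
noncomputable def normalizedGraphForm (α : T3 → E3 →L[ℝ] ℝ) (M : E2 → ℝ) (ρ : T2 → ℝ) (y : E3) :
    E2 →L[ℝ] ℝ :=
  (√(|stdContactVolume α y| / ρ (proj2 y.1)))⁻¹ •
    (α (proj3 y)).comp ((ContinuousLinearMap.id ℝ E2).prod (fderiv ℝ M y.1))

section NormalizedGraphForm

variable {α : T3 → E3 →L[ℝ] ℝ} {M : E2 → ℝ} {ρ : T2 → ℝ}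

theorem normalizedGraphForm_congr (hα : IsContactForm α) {μ : T2 → S1} (hM : Continuous M)
    (hMl : IsLift proj2 proj1 M μ) {x y : E3} (h : proj3 x = proj3 y) :
    normalizedGraphForm α M ρ x = normalizedGraphForm α M ρ y := by
  have h1 : proj2 x.1 = proj2 y.1 := congrArg Prod.fst h
  have h2 := IsLift.fderiv_eq proj1_discrete hM hM hMl hMl h1
  rw [normalizedGraphForm, normalizedGraphForm, stdContactVolume_congr hα.1 h, h1, h2, h]

theorem exists_norm_normalizedGraphForm_le (hα : IsContactForm α) {μ : T2 → S1}
    (hM : ContDiff ℝ 1 M) (hMl : IsLift proj2 proj1 M μ)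
    (hρ : Continuous fun x => ρ (proj2 x)) (hpos : ∀ p, 0 < ρ p) :
    ∃ C, ∀ y, ‖normalizedGraphForm α M ρ y‖ ≤ C := by
  refine exists_norm_le_of_proj3_invariant ?_
    fun x y => normalizedGraphForm_congr hα hM.continuous hMl
  have h1 := continuous_stdContactVolume hα.1
  have h2 : Continuous fun y : E3 => ρ (proj2 y.1) := hρ.comp continuous_fst
  have h3 : Continuous fun y : E3 => fderiv ℝ M y.1 :=
    (hM.continuous_fderiv one_ne_zero).comp continuous_fst
  have h4 : Continuous fun y : E3 => (ContinuousLinearMap.id ℝ E2).prod (fderiv ℝ M y.1) :=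
    (ContinuousLinearMap.prodₗᵢ ℝ : ((E2 →L[ℝ] E2) × (E2 →L[ℝ] ℝ)) ≃ₗᵢ[ℝ] _).continuous.comp
      (continuous_const.prodMk h3)
  unfold normalizedGraphForm
  refine Continuous.smul (f := fun y => (√(|stdContactVolume α y| / ρ (proj2 y.1)))⁻¹)
    (Continuous.inv₀ ?_ fun y => ?_) (hα.1.continuous.clm_comp h4)
  · exact (h1.abs.div h2 fun y => (hpos _).ne').sqrt
  · exact (Real.sqrt_pos.2 (div_pos (abs_pos.2 (stdContactVolume_ne_zero hα y)) (hpos _))).ne'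

theorem normalizedGraphForm_skewLift {G : E2 → E2} (hG : ContDiff ℝ 2 G) (hM : ContDiff ℝ 2 M)
    (hα : IsContactForm α) (hpos : ∀ p, 0 < ρ p) {τ : E3 → ℝ} (hτ : Differentiable ℝ τ)
    (hτpos : ∀ x, 0 < τ x)
    (h : ∀ x v, α (proj3 (skewLift G M x)) (fderiv ℝ (skewLift G M) x v) = τ x * α (proj3 x) v)
    (hdet : ∀ x, |(fderiv ℝ G x).det| * ρ (proj2 (G x)) = ρ (proj2 x)) (y : E3) (v : E2) :
    normalizedGraphForm α M ρ (skewLift G M y) (fderiv ℝ G y.1 v) =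
      normalizedGraphForm α M ρ y v := by
  have hvol := congrArg abs (stdContactVolume_skewLift hG hM hα.1 hτ h y)
  rw [abs_mul, abs_mul, abs_of_nonneg (sq_nonneg (τ y))] at hvol
  have hρ0 := hpos (proj2 (G y.1))
  have hd := hdet y.1
  have hdpos : 0 < |(fderiv ℝ G y.1).det| := by
    refine pos_of_mul_pos_left ?_ hρ0.le
    rw [hd]; exact hpos _
  have hsq : |stdContactVolume α (skewLift G M y)| / ρ (proj2 (skewLift G M y).1) =
      τ y ^ 2 * (|stdContactVolume α y| / ρ (proj2 y.1)) := by
    change _ / ρ (proj2 (G y.1)) = _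
    rw [← hd, div_eq_iff hρ0.ne', mul_div_assoc', ← hvol]
    field_simp
  -- The vector `(v, dM v)` is tangent to a graph, and its image is the tangent vector over `DG v`
  -- to another graph.
  have hval := h y (v, fderiv ℝ M y.1 v)
  rw [fderiv_skewLift (hG.differentiable two_ne_zero) (hM.differentiable two_ne_zero)] at hval
  simp only [add_sub_cancel] at hval
  simp only [normalizedGraphForm, hsq, Real.sqrt_mul (sq_nonneg (τ y)), Real.sqrt_sq (hτpos y).le,
    smul_apply, ContinuousLinearMap.comp_apply, ContinuousLinearMap.prod_apply,
    ContinuousLinearMap.id_apply, smul_eq_mul]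
  change _ * α (proj3 (skewLift G M y)) (fderiv ℝ G y.1 v,
    fderiv ℝ M (G y.1) (fderiv ℝ G y.1 v)) = _
  rw [hval, mul_inv]
  have := (hτpos y).ne'
  field_simp

theorem apply_graph_eq_zero (hα : IsContactForm α) (hpos : ∀ p, 0 < ρ p) {y : E3} {v : E2}
    (h : normalizedGraphForm α M ρ y v = 0) : α (proj3 y) (v, fderiv ℝ M y.1 v) = 0 := by
  refine (mul_eq_zero.1 h).resolve_left (inv_ne_zero ?_)
  exact (Real.sqrt_pos.2 (div_pos (abs_pos.2 (stdContactVolume_ne_zero hα y)) (hpos _))).ne'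

end NormalizedGraphForm

/-! ### Vanishing on contracted vectors and the final contradiction -/

/-- A bounded family of linear forms that is invariant under a fibered map vanishes on vectors
contracted by the base map. -/
theorem eq_zero_of_invariant_of_contracted {G : E2 → E2} (hG : Differentiable ℝ G) {P : E3 → E3}
    (hP : ∀ y, (P y).1 = G y.1) {c : E3 → E2 →L[ℝ] ℝ} {C : ℝ} (hC : ∀ y, ‖c y‖ ≤ C)
    (hc : ∀ y v, c (P y) (fderiv ℝ G y.1 v) = c y v) {y : E3} {v : E2} {B lam : ℝ}
    (hlam0 : 0 < lam) (hlam1 : lam < 1)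
    (hv : ∀ n : ℕ, ‖fderiv ℝ G^[n] y.1 v‖ ≤ B * lam ^ n * ‖v‖) : c y v = 0 := by
  have hfst : ∀ n : ℕ, (P^[n] y).1 = G^[n] y.1 := by
    intro n
    have : Function.Semiconj Prod.fst P G := hP
    exact (this.iterate_right n).eq y
  have hn : ∀ n : ℕ, c (P^[n] y) (fderiv ℝ G^[n] y.1 v) = c y v := by
    intro n
    induction n with
    | zero => simp
    | succ n ih =>
      rw [Function.iterate_succ_apply', Function.iterate_succ',
        fderiv_comp _ (hG _) (hG.iterate n _), ContinuousLinearMap.comp_apply, ← hfst, hc, ih]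
  have hlim : Tendsto (fun n : ℕ => C * (B * lam ^ n * ‖v‖)) atTop (𝓝 0) := by
    have := ((tendsto_pow_atTop_nhds_zero_of_lt_one hlam0.le hlam1).const_mul B).mul_const ‖v‖
    simpa using this.const_mul C
  refine norm_le_zero_iff.1 (ge_of_tendsto' hlim fun n => ?_)
  rw [← hn n]
  refine (ContinuousLinearMap.le_opNorm _ _).trans ?_
  exact mul_le_mul (hC _) (hv n) (norm_nonneg _) ((norm_nonneg _).trans (hC y))

/-- A form that vanishes on the graphs of `M + const` is not a contact form. -/
theorem not_isContactForm_of_graph {α : T3 → E3 →L[ℝ] ℝ} {M : E2 → ℝ} (hM : ContDiff ℝ 2 M)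
    (h : ∀ (y : E3) (v : E2), α (proj3 y) (v, fderiv ℝ M y.1 v) = 0) : ¬ IsContactForm α := by
  intro hα
  obtain ⟨u, v, w, hne⟩ := hα.2 0
  refine hne ?_
  have hM' : Differentiable ℝ (fderiv ℝ M) :=
    (hM.fderiv_right (m := 1) (by norm_num)).differentiable one_ne_zero
  -- `S` pulls forms back along the projection to `ℝ²`, so `θ` below is `dt - dM`, closed by
  -- symmetry of the second derivative of `M`.
  set S : (E2 →L[ℝ] ℝ) →L[ℝ] E3 →L[ℝ] ℝ :=
    (ContinuousLinearMap.compL ℝ E3 E2 ℝ).flip (ContinuousLinearMap.fst ℝ E2 ℝ) with hS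
  have hθ : ∀ y : E3, HasFDerivAt
      (fun y : E3 => ContinuousLinearMap.snd ℝ E2 ℝ - S (fderiv ℝ M y.1))
      (-(S.comp ((fderiv ℝ (fderiv ℝ M) y.1).comp (ContinuousLinearMap.fst ℝ E2 ℝ)))) y := by
    intro y
    have h1 : HasFDerivAt (fun y : E3 => fderiv ℝ M y.1) _ y :=
      (hM' y.1).hasFDerivAt.comp y hasFDerivAt_fst
    exact (S.hasFDerivAt.comp y h1).const_sub _
  refine contactVolume_eq_zero_of_eq_mul_closed (b := fun y => α (proj3 y) (0, 1))
    (θ := fun y => ContinuousLinearMap.snd ℝ E2 ℝ - S (fderiv ℝ M y.1)) ?_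
    (fun y => (hθ y).differentiableAt) ?_ ?_ u v w
  · exact (hα.1.differentiable one_ne_zero).clm_apply (differentiable_const _)
  · intro y
    refine ContinuousLinearMap.ext fun z => ?_
    -- Subtracting a vector tangent to the graph, where `α` vanishes, leaves a vertical vector.
    have hz : z = (z.1, fderiv ℝ M y.1 z.1) + (z.2 - fderiv ℝ M y.1 z.1) • ((0, 1) : E3) :=
      Prod.ext (by simp) (by simp)
    conv_lhs => rw [hz, map_add, h y, map_smul]
    simp [hS, mul_comm]
  · intro p q
    rw [(hθ 0).fderiv]
    have := (hM.contDiffAt.isSymmSndFDerivAt (x := (0 : E3).1) (by simp)).eq p.1 q.1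
    simpa [hS] using this

theorem theoremA (r ℓ : ℕ∞) (hℓ : 2 ≤ ℓ) (hr : ℓ ≤ r)
    (f : T2 ≃ T2) (hf : IsTorusDiffeo proj2 r f) (hA : IsAnosov proj2 f) (hc : IsConservative f)
    (γ : T2 → S1) (hγ : TorusContDiff proj2 proj1 r γ) (hcob : IsCoboundary ℓ f γ) :
    ¬ IsPHContactDiffeo r (skewProduct f γ) := by
  rintro ⟨-, -, α, hα, τ, hτ, hτpos, hF⟩
  obtain ⟨⟨G, hG, hGl⟩, H, hH, hHl⟩ := hf
  obtain ⟨μ, ⟨M, hM, hMl⟩, hγμ⟩ := hcob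
  obtain ⟨-, Es, Eu, -, -, hcompl, -, -, B, -, lam, hlam0, hlam1, hexp⟩ := hA
  obtain ⟨ρ, hρ, hρpos, hmp⟩ := hc
  have h2ℓ : (2 : WithTop ℕ∞) ≤ ℓ := WithTop.coe_le_coe.2 hℓ
  have h2r : (2 : WithTop ℕ∞) ≤ r := WithTop.coe_le_coe.2 (hℓ.trans hr)
  replace hG := hG.of_le h2r
  replace hH := hH.of_le h2r
  replace hM := hM.of_le h2ℓ
  have hGd := hG.differentiable two_ne_zero
  have hHd := hH.differentiable two_ne_zero
  have hPl := isLift_skewLift hGl hMl hγμ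
  have hPd := (contDiff_skewLift hG hM).differentiable two_ne_zero
  -- The inverse is the skew-product over `f⁻¹` by the coboundary of the same `μ`, so it preserves
  -- the same graphs.
  have hQl : IsLift proj3 proj3 (skewLift H M) (skewProduct f γ).symm := by
    have h1 := isLift_skewLift (γ := fun p => μ (f.symm p) - μ p) hHl hMl fun _ => rfl
    have h2 : ⇑(skewProduct f fun p => μ (f p) - μ p).symm =
        skewProduct f.symm fun p => μ (f.symm p) - μ p := by
      funext q
      refine Prod.ext rfl ?_
      change q.2 - (μ (f (f.symm q.1)) - μ (f.symm q.1)) = q.2 + (μ (f.symm q.1) - μ q.1)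
      rw [f.apply_symm_apply]
      abel
    rw [funext hγμ, h2]
    exact h1
  have hinv : ∀ x v, α (proj3 (skewLift G M x)) (fderiv ℝ (skewLift G M) x v) =
      τ (proj3 x) * α (proj3 x) v := by
    intro x v
    rw [← torusDeriv_eq proj3_discrete hPd hPl, hPl]
    exact hF _ v
  have hdet : ∀ x, |(fderiv ℝ G x).det| * ρ (proj2 (G x)) = ρ (proj2 x) := by
    intro x
    rw [hGl]
    exact abs_det_fderiv_mul_density (hG.of_le one_le_two) hGl hρ.continuous hρpos hmp x
  set c := normalizedGraphForm α M ρ with hcdef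
  obtain ⟨C, hC⟩ := exists_norm_normalizedGraphForm_le hα (hM.of_le one_le_two) hMl
    hρ.continuous hρpos
  have hcG : ∀ y v, c (skewLift G M y) (fderiv ℝ G y.1 v) = c y v :=
    normalizedGraphForm_skewLift hG hM hα hρpos (hτ.differentiable (by simp))
      (fun x => hτpos _) hinv hdet
  have hcH : ∀ y v, c (skewLift H M y) (fderiv ℝ H y.1 v) = c y v := by
    intro y v
    have hGH : fderiv ℝ G (skewLift H M y).1 (fderiv ℝ H y.1 v) = v :=
      IsLift.fderiv_comp_fderiv_of_inverse proj2_discrete hGd hHd hGl hHl y.1 v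
    rw [← hcG (skewLift H M y), hGH]
    -- The composite of the two lifts need not be the identity, but it covers the identity, and the
    -- normalized form descends to the torus.
    refine congrArg (fun L => L v) (normalizedGraphForm_congr hα hM.continuous hMl ?_)
    rw [hPl, hQl, Equiv.apply_symm_apply]
  refine not_isContactForm_of_graph hM (fun y v => ?_) hα
  refine apply_graph_eq_zero (ρ := ρ) hα hρpos ?_
  obtain ⟨s, hs, u, hu, rfl⟩ := Submodule.mem_sup.1
    ((hcompl (proj2 y.1)).sup_eq_top ▸ Submodule.mem_top : v ∈ Es (proj2 y.1) ⊔ Eu (proj2 y.1))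
  rw [map_add, ← hcdef,
    eq_zero_of_invariant_of_contracted hGd (fun _ => rfl) hC hcG hlam0 hlam1 (v := s) (B := B),
    eq_zero_of_invariant_of_contracted hHd (fun _ => rfl) hC hcH hlam0 hlam1 (v := u) (B := B),
    add_zero]
  · intro n
    rw [← torusDeriv_eq proj2_discrete (hHd.iterate n) (hHl.iterate n)]
    exact (hexp n _).2 u hu
  · intro n
    rw [← torusDeriv_eq proj2_discrete (hGd.iterate n) (hGl.iterate n)]
    exact (hexp n _).1 s hs
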